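/- Let $n$ and $k$ be integers with $1\le k\le n$. For a $C^2$ function $u:\mathbb{R}^n\to\mathbb{R}$ with $|Du|<1$ everywhere, consider its graph $\mathcal{M}_u=\{(x,u(x)) : x\in\mathbb{R}^n\}$ as a spacelike hypersurface in Minkowski space $\mathbb{R}^{n,1}$ with metric $dx_1^2+\dots+dx_n^2-dx_{n+1}^2$. Its first and second fundamental forms are $$g_{ij}=\delta_{ij}-u_{x_i}u_{x_j},\qquad h_{ij}=\frac{u_{x_ix_j}}{\sqrt{1-|Du|^2}},$$ and its principal curvatures $\kappa[\mathcal{M}_u]=(\kappa_1,\dots,\kappa_n)$ are the eigenvalues, with multiplicity, of the matrix $g^{-1}h$. Let $\sigma_k(\kappa)=\sum_{1\le i_1<\dots<i_k\le n}\kappa_{i_1}\cdots\kappa_{i_k}$. Then there is no convex $C^2$ function $u:\mathbb{R}^n\to\mathbb{R}$ with $|Du|<1$ everywhere such that $$\sigma_k(\kappa[\mathcal{M}_u])=\binom{n}{k}\quad\text{at every point of }\mathcal{M}_u$$ and such that $\mathcal{M}_u$ is strictly spacelike, that is, such that for some constant $\theta<1$ one has $|Du(x)|\le\theta$ for all $x\in\mathbb{R}^n$.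 -/

import Mathlib

noncomputable section

namespace MinkowskiGraph

/-- The partial derivative `∂u/∂xᵢ` at `x`. -/
def partialDeriv {n : ℕ} (u : EuclideanSpace ℝ (Fin n) → ℝ) (x : EuclideanSpace ℝ (Fin n))
    (i : Fin n) : ℝ :=
  fderiv ℝ u x (EuclideanSpace.single i 1)

/-- The Hessian matrix `(∂²u/∂xᵢ∂xⱼ)` of `u` at `x`. -/
def hess {n : ℕ} (u : EuclideanSpace ℝ (Fin n) → ℝ) (x : EuclideanSpace ℝ (Fin n)) :
    Matrix (Fin n) (Fin n) ℝ :=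
  Matrix.of fun i j =>
    fderiv ℝ (fderiv ℝ u) x (EuclideanSpace.single i 1) (EuclideanSpace.single j 1)

/-- The graph `{(x, u(x))}` is spacelike in Minkowski space `ℝ^{n,1}`
(metric `dx₁² + ⋯ + dxₙ² - dxₙ₊₁²`): `|Du| < 1` everywhere. -/
def Spacelike {n : ℕ} (u : EuclideanSpace ℝ (Fin n) → ℝ) : Prop :=
  ∀ x, ‖gradient u x‖ < 1

/-- The graph is strictly spacelike: `|Du| ≤ θ` everywhere for some constant `θ < 1`. -/
def StrictlySpacelike {n : ℕ} (u : EuclideanSpace ℝ (Fin n) → ℝ) : Prop :=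
  ∃ θ : ℝ, θ < 1 ∧ ∀ x, ‖gradient u x‖ ≤ θ

/-- The metric induced on the graph by the Minkowski metric, in the coordinates `x`:
`gᵢⱼ = δᵢⱼ - uᵢ uⱼ`. -/
def firstForm {n : ℕ} (u : EuclideanSpace ℝ (Fin n) → ℝ) (x : EuclideanSpace ℝ (Fin n)) :
    Matrix (Fin n) (Fin n) ℝ :=
  Matrix.of fun i j =>
    (if i = j then 1 else 0) - partialDeriv u x i * partialDeriv u x j

/-- The second fundamental form of the graph with respect to the future directed timelike
unit normal `ν = (Du, 1) / √(1 - |Du|²)`, in the coordinates `x`: `hᵢⱼ = uᵢⱼ / √(1 - |Du|²)`. -/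
def secondForm {n : ℕ} (u : EuclideanSpace ℝ (Fin n) → ℝ) (x : EuclideanSpace ℝ (Fin n)) :
    Matrix (Fin n) (Fin n) ℝ :=
  Matrix.of fun i j => hess u x i j / Real.sqrt (1 - ‖gradient u x‖ ^ 2)

/-- The Weingarten (shape operator) matrix `g⁻¹ h`. -/
def weingarten {n : ℕ} (u : EuclideanSpace ℝ (Fin n) → ℝ) (x : EuclideanSpace ℝ (Fin n)) :
    Matrix (Fin n) (Fin n) ℝ :=
  (firstForm u x)⁻¹ * secondForm u x

/-- The principal curvatures `κ₁, …, κₙ` of the graph at `(x, u(x))`: the eigenvalues of the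
Weingarten matrix, counted with multiplicity. -/
def principalCurvatures {n : ℕ} (u : EuclideanSpace ℝ (Fin n) → ℝ)
    (x : EuclideanSpace ℝ (Fin n)) : Multiset ℝ :=
  (weingarten u x).charpoly.roots

/-- The `σₖ` curvature of the graph at `(x, u(x))`: the `k`-th elementary symmetric polynomial
of the principal curvatures. -/
def sigmaCurvature {n : ℕ} (k : ℕ) (u : EuclideanSpace ℝ (Fin n) → ℝ)
    (x : EuclideanSpace ℝ (Fin n)) : ℝ :=
  (principalCurvatures u x).esymm k

lemma partialDeriv_eq {n : ℕ} (u : EuclideanSpace ℝ (Fin n) → ℝ)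
    (x : EuclideanSpace ℝ (Fin n)) (i : Fin n) : partialDeriv u x i = gradient u x i := by
  have h : inner ℝ (gradient u x) (EuclideanSpace.single i (1 : ℝ)) = partialDeriv u x i := by
    simp [gradient, partialDeriv]
  rw [← h, EuclideanSpace.inner_single_right]
  simp

lemma firstForm_posDef {n : ℕ} (u : EuclideanSpace ℝ (Fin n) → ℝ)
    (x : EuclideanSpace ℝ (Fin n)) (hx : ‖gradient u x‖ < 1) : (firstForm u x).PosDef := by
  have hE : firstForm u x = 1 - Matrix.vecMulVec (partialDeriv u x) (partialDeriv u x) := by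
    ext i j
    simp [firstForm, Matrix.one_apply, Matrix.vecMulVec_apply]
  refine Matrix.PosDef.of_dotProduct_mulVec_pos ?_ ?_
  · ext i j
    simp only [firstForm, Matrix.conjTranspose_apply, Matrix.of_apply, star_trivial, eq_comm]
    ring
  · intro v hv
    have hin : (partialDeriv u x) ⬝ᵥ v = inner ℝ (gradient u x) (WithLp.toLp 2 v) := by
      simp only [PiLp.inner_apply, dotProduct, partialDeriv_eq]
      exact Finset.sum_congr rfl fun i _ => by simp [mul_comm]
    have hvv : v ⬝ᵥ v = ‖WithLp.toLp 2 v‖ ^ 2 := by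
      rw [EuclideanSpace.norm_sq_eq]
      simp [dotProduct, sq]
    have hpos : 0 < ‖WithLp.toLp 2 v‖ := by
      rw [norm_pos_iff]
      simpa using hv
    have hcs := abs_real_inner_le_norm (gradient u x) (WithLp.toLp 2 v)
    rw [hE, Matrix.sub_mulVec, Matrix.one_mulVec, Matrix.vecMulVec_mulVec]
    simp only [star_trivial, dotProduct_sub, dotProduct_smul, op_smul_eq_mul]
    rw [dotProduct_comm v (partialDeriv u x), hin, hvv]
    have h1 : |inner ℝ (gradient u x) (WithLp.toLp 2 v)| < ‖WithLp.toLp 2 v‖ := by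
      nlinarith
    have h2 := sq_lt_sq' (by linarith [(abs_lt.mp h1).1]) (abs_lt.mp h1).2
    nlinarith

lemma secondForm_isHermitian {n : ℕ} (u : EuclideanSpace ℝ (Fin n) → ℝ)
    (hu : ContDiff ℝ 2 u) (x : EuclideanSpace ℝ (Fin n)) : (secondForm u x).IsHermitian := by
  have hs : IsSymmSndFDerivAt ℝ u x := hu.contDiffAt.isSymmSndFDerivAt (by simp)
  ext i j
  simp only [secondForm, hess, Matrix.conjTranspose_apply, Matrix.of_apply, star_trivial]
  rw [hs.eq]

/-- A spacelike `C²` graph has exactly `n` real principal curvatures at each point. -/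
lemma card_principalCurvatures {n : ℕ} (u : EuclideanSpace ℝ (Fin n) → ℝ)
    (hu : ContDiff ℝ 2 u) (x : EuclideanSpace ℝ (Fin n)) (hx : ‖gradient u x‖ < 1) :
    (principalCurvatures u x).card = n := by
  obtain ⟨B, hB⟩ : ∃ B : Matrix (Fin n) (Fin n) ℝ,
      (firstForm u x)⁻¹ = B.conjTranspose * B := by
    open scoped MatrixOrder Matrix.Norms.L2Operator in
    exact CStarAlgebra.nonneg_iff_eq_star_mul_self.mp
      (firstForm_posDef u x hx).inv.posSemidef.nonneg
  have hH : (B * secondForm u x * B.conjTranspose).IsHermitian :=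
    Matrix.isHermitian_mul_mul_conjTranspose B (secondForm_isHermitian u hu x)
  have hc : (weingarten u x).charpoly = (B * secondForm u x * B.conjTranspose).charpoly := by
    rw [weingarten, hB, Matrix.mul_assoc, Matrix.charpoly_mul_comm]
  rw [principalCurvatures, hc, hH.roots_charpoly_eq_eigenvalues]
  simp

end MinkowskiGraph

end

noncomputable section

namespace MinkowskiGraph

open Real Filter Topology

/-! The graph is compared with the hyperboloid `w(y) = √(4 + |y|²)`, all of whose principal
curvatures equal 1/2. Strict spacelikeness makes `w - u` coercive, so it attains a minimum at some
`x` (`exists_touching`). There `Du = Dw` and `D²u ≤ D²w`, so both graphs have the same first form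
and the principal curvatures of `u` are at most 1/2; convexity makes them nonnegative
(`principalCurvatures_mem_Icc`). Hence `σₖ ≤ (n choose k) / 2ᵏ` at `x`, which is less than `n choose
k`. Any radius larger than 1 would serve in place of 2. -/

/-- The second order necessary condition at a global minimum on the line. -/
lemma second_order_of_forall_le {f f' : ℝ → ℝ} {c : ℝ} (hf : ∀ t, HasDerivAt f (f' t) t)
    (hf' : HasDerivAt f' c 0) (hmin : ∀ t, f 0 ≤ f t) : f' 0 = 0 ∧ 0 ≤ c := by
  have h0 : f' 0 = 0 :=
    IsLocalMin.hasDerivAt_eq_zero (Eventually.of_forall hmin : IsLocalMin f 0) (hf 0)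
  refine ⟨h0, ?_⟩
  -- If `c < 0`, then 0 is also a local maximum, so `f` is locally constant and `c = 0`.
  by_contra! hc
  have hd : deriv f = f' := funext fun t => (hf t).deriv
  have hmax : IsLocalMax f 0 := by
    apply isLocalMax_of_deriv_deriv_neg
    · rwa [hd, hf'.deriv]
    · rw [hd, h0]
    · exact (hf 0).continuousAt
  have hconst : f =ᶠ[𝓝 0] fun _ => f 0 := by
    filter_upwards [hmax] with t ht using le_antisymm ht (hmin t)
  have : deriv (deriv f) 0 = 0 := by
    rw [hconst.deriv.deriv_eq]
    simp
  rw [hd, hf'.deriv] at this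
  exact hc.ne this

variable {n : ℕ} {u : EuclideanSpace ℝ (Fin n) → ℝ}

lemma hasDerivAt_line (hu : ContDiff ℝ 2 u) (x v : EuclideanSpace ℝ (Fin n)) (t : ℝ) :
    HasDerivAt (fun t : ℝ => u (x + t • v)) (fderiv ℝ u (x + t • v) v) t := by
  have hl : HasDerivAt (fun t : ℝ => x + t • v) v t := by
    simpa using ((hasDerivAt_id t).smul_const v).const_add x
  exact ((hu.differentiable (by norm_num)) _).hasFDerivAt.comp_hasDerivAt t hl

lemma hasDerivAt_fderiv_line (hu : ContDiff ℝ 2 u) (x v : EuclideanSpace ℝ (Fin n)) :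
    HasDerivAt (fun t : ℝ => fderiv ℝ u (x + t • v) v) (fderiv ℝ (fderiv ℝ u) x v v) 0 := by
  have hl : HasDerivAt (fun t : ℝ => x + t • v) v 0 := by
    simpa using ((hasDerivAt_id (0 : ℝ)).smul_const v).const_add x
  have hd : Differentiable ℝ (fderiv ℝ u) :=
    (hu.fderiv_right (m := 1) (by norm_num)).differentiable (by norm_num)
  have h := (hd (x + (0 : ℝ) • v)).hasFDerivAt.comp_hasDerivAt (0 : ℝ) hl
  simpa using h.clm_apply (hasDerivAt_const (0 : ℝ) v)

lemma fderiv_fderiv_nonneg (hu : ContDiff ℝ 2 u) (hc : ConvexOn ℝ Set.univ u)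
    (x v : EuclideanSpace ℝ (Fin n)) : 0 ≤ fderiv ℝ (fderiv ℝ u) x v v := by
  have hconv : ConvexOn ℝ Set.univ (fun t : ℝ => u (x + t • v)) := by
    refine ⟨convex_univ, fun s _ t _ a b ha hb hab => ?_⟩
    have := hc.2 (Set.mem_univ (x + s • v)) (Set.mem_univ (x + t • v)) ha hb hab
    convert this using 2
    rw [smul_add, smul_add, add_add_add_comm, ← add_smul, hab, one_smul, add_smul, smul_assoc,
      smul_assoc]
  have hd : deriv (fun t : ℝ => u (x + t • v)) = fun t => fderiv ℝ u (x + t • v) v :=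
    funext fun t => (hasDerivAt_line hu x v t).deriv
  have hm : Monotone fun t : ℝ => fderiv ℝ u (x + t • v) v := by
    rw [← hd, ← monotoneOn_univ]
    exact hconv.monotoneOn_deriv fun t _ => (hasDerivAt_line hu x v t).differentiableAt
  rw [← (hasDerivAt_fderiv_line hu x v).deriv]
  exact hm.deriv_nonneg

lemma four_add_norm_sq_line (x v : EuclideanSpace ℝ (Fin n)) (t : ℝ) :
    4 + ‖x + t • v‖ ^ 2 = 4 + ‖x‖ ^ 2 + 2 * t * inner ℝ x v + t ^ 2 * ‖v‖ ^ 2 := by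
  rw [norm_add_sq_real, inner_smul_right, norm_smul, mul_pow, norm_eq_abs, sq_abs]
  ring

/-- If the hyperboloid of curvature `1/2` touches the graph of `u` from above at `x`, the gradients
agree there and the Hessian of `u` is bounded by that of the hyperboloid. -/
lemma derivs_at_touching (hu : ContDiff ℝ 2 u) {x : EuclideanSpace ℝ (Fin n)}
    (hx : ∀ y, √(4 + ‖x‖ ^ 2) - u x ≤ √(4 + ‖y‖ ^ 2) - u y) (v : EuclideanSpace ℝ (Fin n)) :
    fderiv ℝ u x v = inner ℝ x v / √(4 + ‖x‖ ^ 2) ∧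
      fderiv ℝ (fderiv ℝ u) x v v ≤
        (‖v‖ ^ 2 - (fderiv ℝ u x v) ^ 2) / √(4 + ‖x‖ ^ 2) := by
  set W : ℝ → ℝ := fun t => √(4 + ‖x + t • v‖ ^ 2) with hW
  have hpos : ∀ t, 0 < W t := fun t => sqrt_pos.2 (by positivity)
  have hW0 : W 0 = √(4 + ‖x‖ ^ 2) := by simp [hW]
  have hq : ∀ t : ℝ, HasDerivAt (fun t : ℝ => 4 + ‖x + t • v‖ ^ 2)
      (2 * (inner ℝ x v + t * ‖v‖ ^ 2)) t := by
    intro t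
    simp_rw [four_add_norm_sq_line x v]
    have h1 := ((hasDerivAt_id t).const_mul 2).mul_const (inner ℝ x v)
    have h2 := ((hasDerivAt_id t).pow 2).mul_const (‖v‖ ^ 2)
    refine ((h1.const_add (4 + ‖x‖ ^ 2)).add h2).congr_deriv ?_
    simp
    ring
  have hWd : ∀ t, HasDerivAt W ((inner ℝ x v + t * ‖v‖ ^ 2) / W t) t := by
    intro t
    refine ((hq t).sqrt (by positivity)).congr_deriv ?_
    exact mul_div_mul_left _ _ two_ne_zero
  have hWdd : HasDerivAt (fun t => (inner ℝ x v + t * ‖v‖ ^ 2) / W t)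
      ((‖v‖ ^ 2 * W 0 - inner ℝ x v * (inner ℝ x v / W 0)) / W 0 ^ 2) 0 := by
    have h1 := ((hasDerivAt_id (0 : ℝ)).mul_const (‖v‖ ^ 2)).const_add (inner ℝ x v)
    refine (h1.div (hWd 0) (hpos 0).ne').congr_deriv ?_
    simp
  obtain ⟨h1, h2⟩ := second_order_of_forall_le
    (fun t => (hWd t).sub (hasDerivAt_line hu x v t))
    (hWdd.sub (hasDerivAt_fderiv_line hu x v)) (fun t => by simpa [hW] using hx (x + t • v))
  have h1' : fderiv ℝ u x v = inner ℝ x v / W 0 := by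
    simp only [zero_mul, add_zero, zero_smul] at h1
    linarith
  rw [← hW0]
  refine ⟨h1', ?_⟩
  -- Written with `Du v` instead of `⟨x, v⟩`, the second derivative of the hyperboloid is `g(v, v) /
  -- w`, with `g` the first form of `u`.
  rw [h1']
  refine (sub_nonneg.1 h2).trans_eq ?_
  have := (hpos 0).ne'
  field_simp

/-- A bound `θ < 1` on the gradient lets `u` grow at most like `θ|y|`, while the hyperboloid lies
above the cone `|y|`; the difference is at least `(1 - θ)|y| - u(0)`. -/
lemma exists_touching (hu : ContDiff ℝ 2 u) (hs : StrictlySpacelike u) :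
    ∃ x, ∀ y, √(4 + ‖x‖ ^ 2) - u x ≤ √(4 + ‖y‖ ^ 2) - u y := by
  obtain ⟨θ, hθ, hgrad⟩ := hs
  have hd : Differentiable ℝ u := hu.differentiable (by norm_num)
  have hcont : Continuous fun y => √(4 + ‖y‖ ^ 2) - u y := by
    have := hu.continuous
    fun_prop
  refine hcont.exists_forall_le ?_
  have hlin : Tendsto (fun y : EuclideanSpace ℝ (Fin n) => (1 - θ) * ‖y‖ + -u 0)
      (cocompact _) atTop :=
    tendsto_atTop_add_const_right _ _
      ((tendsto_norm_cocompact_atTop).const_mul_atTop (sub_pos.2 hθ))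
  refine tendsto_atTop_mono (fun y => ?_) hlin
  have h1 : ‖u y - u 0‖ ≤ θ * ‖y - 0‖ := by
    refine convex_univ.norm_image_sub_le_of_norm_fderiv_le (𝕜 := ℝ) (fun z _ => hd z)
      (fun z _ => ?_) (Set.mem_univ _) (Set.mem_univ _)
    simpa [gradient] using hgrad z
  rw [sub_zero] at h1
  have h2 : ‖y‖ ≤ √(4 + ‖y‖ ^ 2) := le_sqrt_of_sq_le (by linarith)
  have h3 := (abs_le.1 h1).2
  linarith

lemma dotProduct_firstForm_mulVec (x : EuclideanSpace ℝ (Fin n)) (v : Fin n → ℝ) :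
    v ⬝ᵥ (firstForm u x).mulVec v =
      ‖WithLp.toLp 2 v‖ ^ 2 - (fderiv ℝ u x (WithLp.toLp 2 v)) ^ 2 := by
  have hE : firstForm u x = 1 - Matrix.vecMulVec (partialDeriv u x) (partialDeriv u x) := by
    ext i j
    simp [firstForm, Matrix.one_apply, Matrix.vecMulVec_apply]
  have hin : partialDeriv u x ⬝ᵥ v = fderiv ℝ u x (WithLp.toLp 2 v) := by
    have : fderiv ℝ u x (WithLp.toLp 2 v) = inner ℝ (gradient u x) (WithLp.toLp 2 v) := by
      simp [gradient]
    rw [this]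
    simp only [PiLp.inner_apply, dotProduct, partialDeriv_eq]
    exact Finset.sum_congr rfl fun i _ => by simp [mul_comm]
  have hvv : v ⬝ᵥ v = ‖WithLp.toLp 2 v‖ ^ 2 := by
    rw [EuclideanSpace.norm_sq_eq]
    simp [dotProduct, sq]
  rw [hE, Matrix.sub_mulVec, Matrix.one_mulVec, Matrix.vecMulVec_mulVec]
  simp only [dotProduct_sub, dotProduct_smul, op_smul_eq_mul]
  rw [dotProduct_comm v (partialDeriv u x), hin, hvv, sq (fderiv ℝ u x _)]

lemma dotProduct_secondForm_mulVec (x : EuclideanSpace ℝ (Fin n)) (v : Fin n → ℝ) :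
    v ⬝ᵥ (secondForm u x).mulVec v =
      fderiv ℝ (fderiv ℝ u) x (WithLp.toLp 2 v) (WithLp.toLp 2 v) /
        √(1 - ‖gradient u x‖ ^ 2) := by
  have hv : WithLp.toLp 2 v = ∑ i, v i • EuclideanSpace.single i (1 : ℝ) := by
    ext j
    simp [Finset.sum_apply, Pi.single_apply]
  rw [hv]
  simp only [map_sum, map_smul, _root_.sum_apply, _root_.smul_apply,
    dotProduct, Matrix.mulVec, secondForm, hess, Matrix.of_apply, Finset.mul_sum, Finset.sum_div,
    smul_eq_mul]
  rw [Finset.sum_comm]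
  refine Finset.sum_congr rfl fun i _ => Finset.sum_congr rfl fun j _ => ?_
  ring

/-- A principal curvature is a Rayleigh quotient of the two fundamental forms. -/
lemma exists_of_mem_principalCurvatures {x : EuclideanSpace ℝ (Fin n)}
    (hx : ‖gradient u x‖ < 1) {κ : ℝ} (hκ : κ ∈ principalCurvatures u x) :
    ∃ v : Fin n → ℝ, 0 < v ⬝ᵥ (firstForm u x).mulVec v ∧
      v ⬝ᵥ (secondForm u x).mulVec v = κ * (v ⬝ᵥ (firstForm u x).mulVec v) := by
  have hroot : (weingarten u x).charpoly.eval κ = 0 := (Polynomial.mem_roots'.1 hκ).2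
  rw [Matrix.eval_charpoly, ← Matrix.exists_mulVec_eq_zero_iff] at hroot
  obtain ⟨v, hv0, hv⟩ := hroot
  have hg := firstForm_posDef u x hx
  refine ⟨v, by simpa using hg.dotProduct_mulVec_pos hv0, ?_⟩
  have hw : (weingarten u x).mulVec v = κ • v := by
    rw [Matrix.sub_mulVec, sub_eq_zero] at hv
    rw [← hv]
    ext i
    simp [Matrix.scalar_apply, Matrix.mulVec_diagonal]
  -- Multiplying by `g` turns the eigenvector of `g⁻¹h` into a solution of `h v = κ g v`.
  have hh : (secondForm u x).mulVec v = κ • (firstForm u x).mulVec v := by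
    rw [← Matrix.mulVec_smul, ← hw, Matrix.mulVec_mulVec, weingarten, ← Matrix.mul_assoc,
      Matrix.mul_nonsing_inv _ ((Matrix.isUnit_iff_isUnit_det _).1 hg.isUnit), Matrix.one_mul]
  rw [hh, dotProduct_smul, smul_eq_mul]

lemma principalCurvatures_mem_Icc (hu : ContDiff ℝ 2 u) (hc : ConvexOn ℝ Set.univ u)
    (hsp : Spacelike u) {x : EuclideanSpace ℝ (Fin n)}
    (hx : ∀ y, √(4 + ‖x‖ ^ 2) - u x ≤ √(4 + ‖y‖ ^ 2) - u y) {κ : ℝ}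
    (hκ : κ ∈ principalCurvatures u x) : 0 ≤ κ ∧ κ ≤ 1 / 2 := by
  obtain ⟨v, hpos, hv⟩ := exists_of_mem_principalCurvatures (hsp x) hκ
  have hW : 0 < √(4 + ‖x‖ ^ 2) := sqrt_pos.2 (by positivity)
  have hWsq : √(4 + ‖x‖ ^ 2) ^ 2 = 4 + ‖x‖ ^ 2 := sq_sqrt (by positivity)
  have hgrad : gradient u x = (√(4 + ‖x‖ ^ 2))⁻¹ • x := by
    refine ext_inner_right ℝ fun w => ?_
    rw [inner_smul_left]
    simpa [gradient, div_eq_inv_mul] using (derivs_at_touching hu hx w).1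
  -- The curvature 1/2 arises here: `D²u ≤ g / w`, and dividing by `2 / w` gives `h ≤ g / 2`.
  have hs : √(1 - ‖gradient u x‖ ^ 2) = 2 / √(4 + ‖x‖ ^ 2) := by
    rw [sqrt_eq_iff_mul_self_eq_of_pos (by positivity), hgrad, norm_smul, norm_inv,
      norm_of_nonneg hW.le]
    field_simp
    linarith
  have hle := (derivs_at_touching hu hx (WithLp.toLp 2 v)).2
  have hnn := fderiv_fderiv_nonneg hu hc x (WithLp.toLp 2 v)
  rw [← dotProduct_firstForm_mulVec] at hle
  rw [dotProduct_secondForm_mulVec, hs] at hv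
  set g := v ⬝ᵥ (firstForm u x).mulVec v
  constructor
  · refine nonneg_of_mul_nonneg_left ?_ hpos
    rw [← hv]
    positivity
  · refine le_of_mul_le_mul_right ?_ hpos
    rw [← hv, div_le_iff₀ (by positivity)]
    refine hle.trans_eq ?_
    field_simp

/-- The lower bound is carried along because the induction step multiplies two upper bounds. -/
lemma prod_le_pow_card_of_mem_Icc {s : Multiset ℝ} {c : ℝ} (h : ∀ a ∈ s, 0 ≤ a ∧ a ≤ c) :
    0 ≤ s.prod ∧ s.prod ≤ c ^ s.card := by
  induction s using Multiset.induction_on with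
  | empty => simp
  | cons a s ih =>
    obtain ⟨h0, h1⟩ := ih fun b hb => h b (Multiset.mem_cons_of_mem hb)
    obtain ⟨ha0, ha1⟩ := h a (Multiset.mem_cons_self a s)
    rw [Multiset.prod_cons, Multiset.card_cons, pow_succ']
    exact ⟨mul_nonneg ha0 h0, mul_le_mul ha1 h1 h0 (ha0.trans ha1)⟩

lemma esymm_le_choose_mul_pow {s : Multiset ℝ} {c : ℝ} (h : ∀ a ∈ s, 0 ≤ a ∧ a ≤ c) (k : ℕ) :
    s.esymm k ≤ s.card.choose k * c ^ k := by
  have := Multiset.sum_le_card_nsmul ((s.powersetCard k).map Multiset.prod) (c ^ k) (by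
    intro p hp
    obtain ⟨t, ht, rfl⟩ := Multiset.mem_map.1 hp
    obtain ⟨hts, rfl⟩ := Multiset.mem_powersetCard.1 ht
    exact (prod_le_pow_card_of_mem_Icc fun a ha => h a (Multiset.mem_of_le hts ha)).2)
  simpa [Multiset.esymm] using this

end MinkowskiGraph

end

theorem corollary1p2 (n k : ℕ) (hk : 1 ≤ k) (hkn : k ≤ n) :
    ¬ ∃ u : EuclideanSpace ℝ (Fin n) → ℝ,
      ContDiff ℝ 2 u ∧
      ConvexOn ℝ Set.univ u ∧
      MinkowskiGraph.Spacelike u ∧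
      (∀ x, MinkowskiGraph.sigmaCurvature k u x = (n.choose k : ℝ)) ∧
      MinkowskiGraph.StrictlySpacelike u := by
  rintro ⟨u, hu, hc, hsp, hσ, hss⟩
  obtain ⟨x, hx⟩ := MinkowskiGraph.exists_touching hu hss
  have hle := MinkowskiGraph.esymm_le_choose_mul_pow
    (fun κ hκ => MinkowskiGraph.principalCurvatures_mem_Icc hu hc hsp hx hκ) k
  -- The number of real roots must be exactly `n` for the binomial coefficients to cancel.
  rw [MinkowskiGraph.card_principalCurvatures u hu x (hsp x)] at hle
  have hσx : (MinkowskiGraph.principalCurvatures u x).esymm k = n.choose k := hσ x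
  have hchoose : (0 : ℝ) < n.choose k := by exact_mod_cast Nat.choose_pos hkn
  -- Strictness needs `k ≥ 1`.
  have hpow : (1 / 2 : ℝ) ^ k < 1 := pow_lt_one₀ (by norm_num) (by norm_num) (by omega)
  rw [hσx] at hle
  nlinarith
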